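/- Let $D$ be a Euclidean domain with quotient field $K$, let $\sigma$ be an automorphism of $D$ and let $\delta\colon D\to D$ be a pseudo-derivation with respect to $\sigma$, that is, $\delta(a+b)=\delta(a)+\delta(b)$ and $\delta(ab)=\sigma(a)\delta(b)+\delta(a)b$. Let $D[x;\sigma,\delta]$ be the Ore polynomial ring with $xa=\sigma(a)x+\delta(a)$ for $a\in D$, and let $K[x;\sigma,\delta]$ be the Ore polynomial ring over $K$ for the extensions of $\sigma$ and $\delta$ to $K$, given by $\sigma(a/b)=\sigma(a)/\sigma(b)$ and $\delta(a/b)=(b\,\delta(a)-a\,\delta(b))/(b\,\sigma(b))$. Write $\operatorname{lc}(P)$ for the leading coefficient and $d_P$ for the degree in $x$ (the order) of an operator $P$. The content $\operatorname{cont}(P)$ of $P\in D[x;\sigma,\delta]$ is the greatest common divisor of its coefficients if $D$ is not a field, and $\operatorname{lc}(P)$ if $D$ is a field. For $n\ge 0$ put $a^{[n]}=\prod_{i=0}^{n-1}\sigma^i(a)$, and put $a^{[-1]}=1/\sigma^{-1}(a)$ for $a\neq0$. Let $A,B\in D[x;\sigma,\delta]$ with $B\neq 0$ and $d_A\ge d_B$,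 and let $R_0,\dots,R_{\ell+1}$ be the subresultant polynomial remainder sequence of $A$ and $B$ (not necessarily normal): $R_i\in K[x;\sigma,\delta]$, $R_0=A$, $R_1=B$, all $R_i$ are nonzero except for $R_{\ell+1}=0$, and, with $d_i=d_{R_i}$, there are $Q_1,\dots,Q_\ell\in K[x;\sigma,\delta]$ such that for $1\le i\le \ell$ $$\alpha_iR_{i-1}=Q_iR_i+\beta_iR_{i+1},\qquad R_{i+1}=0\ \text{ or }\ d_{i+1}<d_i,$$ where $\alpha_i=\operatorname{lc}(R_i)^{[d_{i-1}-d_i+1]}$, where $\beta_1=-\sigma(\psi_1)^{[d_0-d_1]}$ and $\beta_i=-\operatorname{lc}(R_{i-1})\,\sigma(\psi_i)^{[d_{i-1}-d_i]}$ for $2\le i\le\ell$, and where $\psi_1=-1$ and $$\psi_i=\frac{(-\operatorname{lc}(R_{i-1}))^{[d_{i-2}-d_{i-1}]}}{\sigma(\psi_{i-1})^{[d_{i-2}-d_{i-1}-1]}}\qquad\text{for } 2\le i\le\ell.$$ Let $t\in D$ be a greatest common divisor of $\sigma^{d_B-1}(\operatorname{lc}(A))$ and $\sigma^{d_A-1}(\operatorname{lc}(B))$,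 and put $\gamma_2=\sigma^{-d_B+1}(t)$ and $\gamma_i=\sigma^{d_{i-2}-d_{i-1}}(\gamma_{i-1})$ for $2<i\le\ell$. Then for every $2\le i\le\ell$ the operator $R_i$ has all its coefficients in $D$, and $\gamma_i\mid\operatorname{cont}(R_i)$ in $D$. -/

import Mathlib

noncomputable section

namespace Ore

/-- A pseudo-derivation with respect to the automorphism `σ`. -/
structure PseudoDerivation {F : Type*} [CommRing F] (σ : RingAut F) where
  /-- the underlying additive map -/
  toHom : F →+ F
  leibniz : ∀ a b : F, toHom (a * b) = σ a * toHom b + toHom a * b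

section Polynomials

variable {F : Type*} [CommRing F] {σ : RingAut F}

/-- `p ↦ ∑ δ(pᵢ) xⁱ`. -/
def mapCoeff (f : F →+ F) : Polynomial F →+ Polynomial F where
  toFun p := p.sum fun n a => Polynomial.monomial n (f a)
  map_zero' := by simp
  map_add' p q := by
    apply Polynomial.sum_add_index <;> simp

/-- Left multiplication by `x`, that is `∑ aᵢ xⁱ ↦ ∑ (σ(aᵢ) xⁱ⁺¹ + δ(aᵢ) xⁱ)`. -/
def xMul (δ : PseudoDerivation σ) : AddMonoid.End (Polynomial F) :=
  (AddMonoidHom.mulLeft Polynomial.X).comp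
    (Polynomial.mapRingHom (σ : F →+* F)).toAddMonoidHom + mapCoeff δ.toHom

/-- Left multiplication by the constant `a`. -/
def cMul (a : F) : AddMonoid.End (Polynomial F) := AddMonoidHom.mulLeft (Polynomial.C a)

theorem end_mul_apply (f g : AddMonoid.End (Polynomial F)) (p : Polynomial F) :
    (f * g) p = f (g p) := rfl

theorem end_add_apply (f g : AddMonoid.End (Polynomial F)) (p : Polynomial F) :
    (f + g) p = f p + g p := rfl

theorem cMul_apply (a : F) (p : Polynomial F) : cMul a p = Polynomial.C a * p := rfl

theorem cMul_zero : cMul (0 : F) = 0 := by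
  ext1 p; rw [cMul_apply, map_zero, zero_mul]; rfl

theorem cMul_add (a b : F) : cMul (a + b) = cMul a + cMul b := by
  ext1 p; rw [end_add_apply, cMul_apply, cMul_apply, cMul_apply, map_add, add_mul]

theorem cMul_mul (a b : F) : cMul (a * b) = cMul a * cMul b := by
  ext1 p; rw [end_mul_apply, cMul_apply, cMul_apply, cMul_apply, map_mul, mul_assoc]

theorem cMul_one : cMul (1 : F) = 1 := by
  ext1 p; rw [cMul_apply, map_one, one_mul]; rfl

theorem cMul_monomial (a b : F) (n : ℕ) :
    cMul a (Polynomial.monomial n b) = Polynomial.monomial n (a * b) := by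
  rw [cMul_apply, Polynomial.C_mul_monomial]

/-- Left multiplication by `∑ aᵢ xⁱ` in the Ore polynomial ring: the operator `∑ aᵢ · xMulⁱ`. -/
def lMul (δ : PseudoDerivation σ) : Polynomial F →+ AddMonoid.End (Polynomial F) where
  toFun p := p.sum fun n a => cMul a * xMul δ ^ n
  map_zero' := by simp
  map_add' p q := by
    apply Polynomial.sum_add_index
    · intro i; rw [cMul_zero, zero_mul]
    · intro i a b; rw [cMul_add, add_mul]

theorem lMul_monomial (δ : PseudoDerivation σ) (n : ℕ) (a : F) :
    lMul δ (Polynomial.monomial n a) = cMul a * xMul δ ^ n :=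
  Polynomial.sum_monomial_index a (fun n a => cMul a * xMul δ ^ n) (by rw [cMul_zero, zero_mul])

theorem xMul_apply (δ : PseudoDerivation σ) (p : Polynomial F) :
    xMul δ p = Polynomial.X * p.map (σ : F →+* F) + mapCoeff δ.toHom p := rfl

theorem xMul_monomial (δ : PseudoDerivation σ) (n : ℕ) (a : F) :
    xMul δ (Polynomial.monomial n a) =
      Polynomial.monomial (n + 1) (σ a) + Polynomial.monomial n (δ.toHom a) := by
  have h : mapCoeff δ.toHom (Polynomial.monomial n a) = Polynomial.monomial n (δ.toHom a) :=
    Polynomial.sum_monomial_index a (fun n a => Polynomial.monomial n (δ.toHom a)) (by simp)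
  rw [xMul_apply, h, Polynomial.map_monomial, Polynomial.X_mul_monomial]
  rfl

theorem PseudoDerivation.map_one (δ : PseudoDerivation σ) : δ.toHom 1 = 0 := by
  have h := δ.leibniz 1 1
  simpa using h

theorem xMul_mul_cMul (δ : PseudoDerivation σ) (a : F) :
    xMul δ * cMul a = cMul (σ a) * xMul δ + cMul (δ.toHom a) := by
  ext1 q
  induction q using Polynomial.induction_on' with
  | add p q hp hq => rw [map_add, hp, hq, ← map_add]
  | monomial n b =>
    rw [end_add_apply, end_mul_apply, end_mul_apply, cMul_monomial, xMul_monomial, xMul_monomial,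
      map_add, cMul_monomial, cMul_monomial, cMul_monomial, map_mul, δ.leibniz, map_add]
    abel

theorem lMul_cMul (δ : PseudoDerivation σ) (a : F) (p : Polynomial F) :
    lMul δ (cMul a p) = cMul a * lMul δ p := by
  induction p using Polynomial.induction_on' with
  | add p q hp hq => rw [map_add, map_add, hp, hq, map_add, mul_add]
  | monomial n b => rw [cMul_monomial, lMul_monomial, lMul_monomial, ← mul_assoc, cMul_mul]

theorem lMul_xMul (δ : PseudoDerivation σ) (p : Polynomial F) :
    lMul δ (xMul δ p) = xMul δ * lMul δ p := by
  induction p using Polynomial.induction_on' with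
  | add p q hp hq => rw [map_add, map_add, hp, hq, map_add, mul_add]
  | monomial n b =>
    rw [xMul_monomial, map_add, lMul_monomial, lMul_monomial, lMul_monomial, ← mul_assoc,
      xMul_mul_cMul, add_mul, pow_succ', mul_assoc]

theorem lMul_lMul (δ : PseudoDerivation σ) (p q : Polynomial F) :
    lMul δ (lMul δ p q) = lMul δ p * lMul δ q := by
  induction p using Polynomial.induction_on' with
  | add p r hp hr => rw [map_add, end_add_apply, map_add, hp, hr, add_mul]
  | monomial n b =>
    rw [lMul_monomial, end_mul_apply, lMul_cMul, mul_assoc]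
    congr 1
    induction n with
    | zero => rw [pow_zero, one_mul]; rfl
    | succ n ih => rw [pow_succ', end_mul_apply, lMul_xMul, ih, mul_assoc]

theorem lMul_one (δ : PseudoDerivation σ) : lMul δ 1 = 1 := by
  rw [← Polynomial.monomial_zero_one, lMul_monomial, pow_zero, cMul_one, mul_one]

theorem lMul_apply_one (δ : PseudoDerivation σ) (p : Polynomial F) : lMul δ p 1 = p := by
  induction p using Polynomial.induction_on' with
  | add p r hp hr => rw [map_add, end_add_apply, hp, hr]
  | monomial n b =>
    have h : (xMul δ ^ n) 1 = Polynomial.monomial n 1 := by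
      induction n with
      | zero => rfl
      | succ n ih => rw [pow_succ', end_mul_apply, ih, xMul_monomial]; simp [δ.map_one]
    rw [lMul_monomial, end_mul_apply, h, cMul_monomial, mul_one]

end Polynomials

/-- The Ore polynomial ring `F[x; σ, δ]`: its elements are the univariate polynomials over `F`,
written with coefficients on the left. The type is a synonym; the multiplication is not the
commutative one, it is given below. -/
def OrePoly {F : Type*} [CommRing F] {σ : RingAut F} (_δ : PseudoDerivation σ) : Type _ :=
  Polynomial F

namespace OrePoly

section Ring

variable {F : Type*} [CommRing F] {σ : RingAut F} {δ : PseudoDerivation σ}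

instance : AddCommGroup (OrePoly δ) := inferInstanceAs (AddCommGroup (Polynomial F))

/-- The underlying polynomial. -/
def toPoly : OrePoly δ ≃+ Polynomial F := AddEquiv.refl (Polynomial F)

instance : Mul (OrePoly δ) := ⟨fun A B => toPoly.symm (lMul δ (toPoly A) (toPoly B))⟩

instance : One (OrePoly δ) := ⟨toPoly.symm 1⟩

theorem toPoly_mul (A B : OrePoly δ) : toPoly (A * B) = lMul δ (toPoly A) (toPoly B) := rfl

theorem toPoly_one : toPoly (1 : OrePoly δ) = 1 := rfl

instance : Ring (OrePoly δ) where
  __ := (inferInstance : AddCommGroup (OrePoly δ))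
  left_distrib A B C := toPoly.injective <| by simp only [toPoly_mul, map_add]
  right_distrib A B C := toPoly.injective <| by
    simp only [toPoly_mul, map_add, end_add_apply]
  zero_mul A := toPoly.injective <| by simp [toPoly_mul]
  mul_zero A := toPoly.injective <| by simp [toPoly_mul]
  mul_assoc A B C := toPoly.injective <| by
    simp only [toPoly_mul, lMul_lMul, end_mul_apply]
  one_mul A := toPoly.injective <| by simp [toPoly_mul, toPoly_one, lMul_one]
  mul_one A := toPoly.injective <| by rw [toPoly_mul, toPoly_one, lMul_apply_one]

/-- Constants. -/
def C (a : F) : OrePoly δ := toPoly.symm (Polynomial.C a)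

/-- The indeterminate. -/
def X : OrePoly δ := toPoly.symm Polynomial.X

/-- The commutation rule `x a = σ(a) x + δ(a)`. -/
theorem X_mul_C (a : F) : (X : OrePoly δ) * C a = C (σ a) * X + C (δ.toHom a) :=
  toPoly.injective <| by
    simp only [X, C, toPoly_mul, map_add, AddEquiv.apply_symm_apply]
    rw [← Polynomial.monomial_one_one_eq_X, ← Polynomial.monomial_zero_left,
      ← Polynomial.monomial_zero_left, ← Polynomial.monomial_zero_left, lMul_monomial,
      lMul_monomial, pow_one, pow_zero, mul_one, cMul_one, one_mul, xMul_monomial, cMul_monomial,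
      mul_one]

/-- The coefficient of `xⁿ`. -/
def coeff (A : OrePoly δ) (n : ℕ) : F := (toPoly A).coeff n

/-- The degree in `x`, with value `⊥` at `0`. -/
def degree (A : OrePoly δ) : WithBot ℕ := (toPoly A).degree

/-- The order of an operator, i.e. its degree in `x` (used for nonzero operators). -/
def order (A : OrePoly δ) : ℕ := (toPoly A).natDegree

/-- The leading coefficient. -/
def lc (A : OrePoly δ) : F := (toPoly A).leadingCoeff

end Ring

end OrePoly

/-- `g` is a greatest common divisor of `a` and `b`. -/
def IsGCD {D : Type*} [CommRing D] (g a b : D) : Prop :=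
  g ∣ a ∧ g ∣ b ∧ ∀ c : D, c ∣ a → c ∣ b → c ∣ g

open Classical in
/-- The content: the greatest common divisor of the coefficients (the generator, unique up to
units, of the ideal they span), and the leading coefficient if `D` is a field. -/
def content {D : Type*} [EuclideanDomain D] {σ : RingAut D} {δ : PseudoDerivation σ}
    (A : OrePoly δ) : D :=
  if IsField D then A.lc
  else Submodule.IsPrincipal.generator (Ideal.span (Set.range A.coeff))

section Fractions

variable {D : Type*} [CommRing D]
  (K : Type*) [Field K] [Algebra D K] [IsFractionRing D K]

/-- The extension of `σ` to the quotient field. -/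
def fracAut (σ : RingAut D) : RingAut K := IsFractionRing.ringEquivOfRingEquiv σ

theorem fracAut_algebraMap (σ : RingAut D) (a : D) : fracAut K σ (algebraMap D K a) = algebraMap D K (σ a) :=
  IsFractionRing.ringEquivOfRingEquiv_algebraMap σ a

variable {σ : RingAut D} (δ : PseudoDerivation σ)

/-- The value `(b δ(a) - a δ(b)) / (b σ(b))`. -/
def fracDerivAux (a b : D) : K :=
  algebraMap D K (b * δ.toHom a - a * δ.toHom b) / algebraMap D K (b * σ b)

theorem fracDerivAux_mul (a b c : D) (hb : b ≠ 0) (hc : c ≠ 0) :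
    fracDerivAux K δ (a * c) (b * c) = fracDerivAux K δ a b := by
  have hinj := IsFractionRing.injective D K
  have hσ : ∀ d : D, d ≠ 0 → algebraMap D K (σ d) ≠ 0 := fun d hd => by
    rw [Ne, map_eq_zero_iff _ hinj, map_eq_zero_iff _ σ.injective]; exact hd
  have h0 : ∀ d : D, d ≠ 0 → algebraMap D K d ≠ 0 := fun d hd => by
    rwa [Ne, map_eq_zero_iff _ hinj]
  have h1 := hσ b hb
  have h2 := hσ c hc
  have h3 := h0 b hb
  have h4 := h0 c hc
  unfold fracDerivAux
  rw [mul_comm a c, mul_comm b c, δ.leibniz c a, δ.leibniz c b]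
  simp only [map_mul, map_sub, map_add]
  field_simp
  ring

theorem fracDerivAux_congr (a b c d : D) (hb : b ≠ 0) (hd : d ≠ 0) (h : a * d = c * b) :
    fracDerivAux K δ a b = fracDerivAux K δ c d := by
  rw [← fracDerivAux_mul K δ a b d hb hd, h, mul_comm b d, fracDerivAux_mul K δ c d b hd hb]

variable [IsDomain D]

/-- The map `a / b ↦ (b δ(a) - a δ(b)) / (b σ(b))` on the quotient field. -/
def fracDeriv (u : K) : K :=
  fracDerivAux K δ (IsLocalization.sec (nonZeroDivisors D) u).1
    (IsLocalization.sec (nonZeroDivisors D) u).2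

theorem fracDeriv_div (a b : D) (hb : b ≠ 0) :
    fracDeriv K δ (algebraMap D K a / algebraMap D K b) = fracDerivAux K δ a b := by
  have hinj := IsFractionRing.injective D K
  have hb' : algebraMap D K b ≠ 0 := by rwa [Ne, map_eq_zero_iff _ hinj]
  have hs := IsLocalization.sec_spec (nonZeroDivisors D) (algebraMap D K a / algebraMap D K b)
  apply fracDerivAux_congr K δ _ _ _ _ (nonZeroDivisors.ne_zero (Subtype.property _)) hb
  apply hinj
  rw [map_mul, map_mul, ← hs]
  field_simp

/-- The extension of `δ` to the quotient field. -/
def fracDer : PseudoDerivation (fracAut K σ) where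
  toHom := AddMonoidHom.mk' (fracDeriv K δ) <| fun u v => by
    have hinj := IsFractionRing.injective D K
    obtain ⟨a, b, hb, rfl⟩ := IsFractionRing.div_surjective (A := D) u
    obtain ⟨c, d, hd, rfl⟩ := IsFractionRing.div_surjective (A := D) v
    have hb := nonZeroDivisors.ne_zero hb
    have hd := nonZeroDivisors.ne_zero hd
    have h0 : ∀ d : D, d ≠ 0 → algebraMap D K d ≠ 0 := fun d hd => by
      rwa [Ne, map_eq_zero_iff _ hinj]
    have e : algebraMap D K a / algebraMap D K b + algebraMap D K c / algebraMap D K d =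
        algebraMap D K (a * d + c * b) / algebraMap D K (b * d) := by
      have := h0 b hb
      have := h0 d hd
      simp only [map_add, map_mul]
      field_simp
    rw [e, fracDeriv_div K δ _ _ (mul_ne_zero hb hd), fracDeriv_div K δ _ _ hb,
      fracDeriv_div K δ _ _ hd, ← fracDerivAux_mul K δ a b d hb hd,
      ← fracDerivAux_mul K δ c d b hd hb, mul_comm d b]
    unfold fracDerivAux
    rw [← add_div, ← map_add, map_add δ.toHom]
    congr 2
    ring
  leibniz u v := by
    have hinj := IsFractionRing.injective D K
    obtain ⟨a, b, hb, rfl⟩ := IsFractionRing.div_surjective (A := D) u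
    obtain ⟨c, d, hd, rfl⟩ := IsFractionRing.div_surjective (A := D) v
    have hb := nonZeroDivisors.ne_zero hb
    have hd := nonZeroDivisors.ne_zero hd
    have h0 : ∀ d : D, d ≠ 0 → algebraMap D K d ≠ 0 := fun d hd => by
      rwa [Ne, map_eq_zero_iff _ hinj]
    have hσ : ∀ d : D, d ≠ 0 → algebraMap D K (σ d) ≠ 0 := fun d hd => by
      rw [Ne, map_eq_zero_iff _ hinj, map_eq_zero_iff _ σ.injective]; exact hd
    have h1 := h0 b hb
    have h2 := h0 d hd
    have h3 := hσ b hb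
    have h4 := hσ d hd
    simp only [AddMonoidHom.mk'_apply]
    rw [div_mul_div_comm, ← map_mul, ← map_mul, fracDeriv_div K δ _ _ (mul_ne_zero hb hd),
      fracDeriv_div K δ _ _ hb, fracDeriv_div K δ _ _ hd, map_div₀, fracAut_algebraMap,
      fracAut_algebraMap]
    have e1 : b * d * δ.toHom (a * c) - a * c * δ.toHom (b * d) =
        b * d * (σ a * δ.toHom c + δ.toHom a * c) - a * c * (σ b * δ.toHom d + δ.toHom b * d) := by
      rw [δ.leibniz, δ.leibniz]
    have e : ∀ y : D, algebraMap D K (σ y) * algebraMap D K (δ.toHom d) +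
        algebraMap D K (δ.toHom y) * algebraMap D K d =
        algebraMap D K (σ d) * algebraMap D K (δ.toHom y) +
        algebraMap D K (δ.toHom d) * algebraMap D K y := fun y => by
      simp only [← map_mul, ← map_add]
      rw [← δ.leibniz, ← δ.leibniz, mul_comm]
    unfold fracDerivAux
    rw [e1]
    simp only [map_mul, map_sub, map_add]
    field_simp
    linear_combination algebraMap D K c * algebraMap D K b * e a -
      algebraMap D K c * algebraMap D K a * e b

theorem fracDer_div (a b : D) (hb : b ≠ 0) :
    (fracDer K δ).toHom (algebraMap D K a / algebraMap D K b) =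
      algebraMap D K (b * δ.toHom a - a * δ.toHom b) / algebraMap D K (b * σ b) :=
  fracDeriv_div K δ a b hb

/-- The inclusion of `D[x; σ, δ]` in `K[x; σ, δ]`. -/
def toFrac (A : OrePoly δ) : OrePoly (fracDer K δ) :=
  OrePoly.toPoly.symm ((OrePoly.toPoly A).map (algebraMap D K))

end Fractions

section PRS

/-- The `σ`-factorial `a^[n] = a σ(a) ⋯ σⁿ⁻¹(a)`, extended to negative `n` by
`a^[-n] = 1 / (σ⁻¹(a) ⋯ σ⁻ⁿ(a))`, so that `a^[m + n] = a^[m] σᵐ(a^[n])` for all nonzero `a`. -/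
def sigmaFactorial {K : Type*} [Field K] (σ : RingAut K) (a : K) : ℤ → K
  | Int.ofNat n => ∏ i ∈ Finset.range n, (σ ^ i) a
  | Int.negSucc n => (∏ i ∈ Finset.range (n + 1), (σ ^ (-((i : ℤ) + 1))) a)⁻¹

variable {K : Type*} [Field K] {σ : RingAut K} {δ : PseudoDerivation σ}

/-- `R 0, …, R (ℓ + 1)` is a polynomial remainder sequence of `A` and `B` with quotients
`Q 1, …, Q ℓ` and multipliers `α 1, …, α ℓ`, `β 1, …, β ℓ`. -/
structure IsPRS (A B : OrePoly δ) (ℓ : ℕ) (R Q : ℕ → OrePoly δ) (α β : ℕ → K) : Prop where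
  zero : R 0 = A
  one : R 1 = B
  rem : ∀ i, 1 ≤ i → i ≤ ℓ →
    OrePoly.C (α i) * R (i - 1) = Q i * R i + OrePoly.C (β i) * R (i + 1)
  degree_lt : ∀ i, 1 ≤ i → i ≤ ℓ → (R (i + 1)).degree < (R i).degree
  ne_zero : ∀ i, i ≤ ℓ → R i ≠ 0
  last : R (ℓ + 1) = 0

/-- The difference `d_i - d_(i+1)` of the orders of two consecutive terms. -/
def orderDiff (R : ℕ → OrePoly δ) (i : ℕ) : ℤ := ((R i).order : ℤ) - ((R (i + 1)).order : ℤ)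

/-- `ψ_1, ψ_2, …` (the value at `0` is not used). -/
def sresPsi (R : ℕ → OrePoly δ) : ℕ → K
  | 0 => -1
  | 1 => -1
  | i + 2 => sigmaFactorial σ (-(R (i + 1)).lc) (orderDiff R i) /
      sigmaFactorial σ (σ (sresPsi R (i + 1))) (orderDiff R i - 1)

/-- `α_i = lc(R_i)^[d_(i-1) - d_i + 1]`. -/
def sresAlpha (R : ℕ → OrePoly δ) (i : ℕ) : K :=
  sigmaFactorial σ (R i).lc (orderDiff R (i - 1) + 1)

/-- `β_1 = -σ(ψ_1)^[d_0 - d_1]` and `β_i = -lc(R_(i-1)) σ(ψ_i)^[d_(i-1) - d_i]` for `i ≥ 2`. -/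
def sresBeta (R : ℕ → OrePoly δ) (i : ℕ) : K :=
  if i = 1 then -sigmaFactorial σ (σ (sresPsi R 1)) (orderDiff R 0)
  else -(R (i - 1)).lc * sigmaFactorial σ (σ (sresPsi R i)) (orderDiff R (i - 1))

/-- `R 0, …, R (ℓ + 1)` is the subresultant polynomial remainder sequence of `A` and `B`. -/
def IsSubresultantPRS (A B : OrePoly δ) (ℓ : ℕ) (R : ℕ → OrePoly δ) : Prop :=
  ∃ Q : ℕ → OrePoly δ, IsPRS A B ℓ R Q (sresAlpha R) (sresBeta R)

end PRS

end Ore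

end

/-! Up to sign, each `R i` with `2 ≤ i` is a polynomial subresultant of `A` and `B`; integrality and
the common factor are then visible in the rows defining that subresultant. Subresultants are
modelled without determinants. Wedge the shifts `x^k A` with the shifts `x^k B` in the exterior
algebra, then contract with the coefficient functionals of all degrees above `j`; a vector, i.e. an
operator, remains (`subres`). A division step `α a = q b + β r` acts simply on such wedges. Scalars
come out as `σ`-factorials (`shiftProd_smul`), multiples of `b` vanish (`shiftProd_add_mul`), and
surplus rows of `b` contract to leading coefficients (`topContract_shiftProd_mul`). The recursion
for `ψ` is exactly what makes these factors cancel along the sequence (`smul_subres_eq`), giving `R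
(i + 2) = ± subres` of index `d_(i+1) - 1` (`subres_eq_smul_ι`). All rows have coefficients in `D`,
so the subresultant does too. In the top degree only the first row of each block is nonzero, with
entries `σ^m (lc A)` and `σ^n (lc B)`. Both are divisible by `γ_i`, hence so is the whole
subresultant (`exists_subres_map_eq`). -/

noncomputable section

namespace Ore

open Polynomial

/-! ### `σ`-factorials with natural exponents. -/

section Factorial

variable {F : Type*} [CommRing F] (σ : RingAut F)

/-- The `σ`-factorial `a^[n] = a σ(a) ⋯ σⁿ⁻¹(a)` for natural exponents. -/
def fac (a : F) (n : ℕ) : F := ∏ i ∈ Finset.range n, (σ ^ i) a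

theorem fac_zero (a : F) : fac σ a 0 = 1 := Finset.prod_range_zero _

theorem fac_succ (a : F) (n : ℕ) : fac σ a (n + 1) = fac σ a n * (σ ^ n) a :=
  Finset.prod_range_succ _ _

theorem fac_one (a : F) : fac σ a 1 = a := by simp [fac]

theorem one_fac (n : ℕ) : fac σ 1 n = 1 := by simp [fac]

theorem fac_mul (a b : F) (n : ℕ) : fac σ (a * b) n = fac σ a n * fac σ b n := by
  simp [fac, Finset.prod_mul_distrib]

theorem fac_add (a : F) (m n : ℕ) : fac σ a (m + n) = fac σ a m * (σ ^ m) (fac σ a n) := by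
  simp only [fac, Finset.prod_range_add, map_prod, pow_add, RingAut.mul_apply]

theorem pow_fac (a : F) (k n : ℕ) : (σ ^ k) (fac σ a n) = fac σ ((σ ^ k) a) n := by
  simp only [fac, map_prod, ← RingAut.mul_apply, ← pow_add, add_comm]

theorem map_fac (a : F) (n : ℕ) : σ (fac σ a n) = fac σ (σ a) n := by
  simpa using pow_fac σ a 1 n

/-- The left side multiplies `σ^(i+j) a` over the rectangle `i ≤ m`, `j ≤ n`. The hook formed by the
row `i = 0` and the column `j = n` meets each exponent `0, …, n + m` once; what remains is an `m ×
n` rectangle with exponents raised by one. -/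
theorem fac_fac (a : F) (m n : ℕ) :
    fac σ (fac σ a (n + 1)) (m + 1) = fac σ a (n + m + 1) * fac σ (fac σ (σ a) n) m := by
  induction m with
  | zero => simp [fac_one, fac_zero]
  | succ m ih =>
    have h := fac_add σ a (m + 1) (n + 1)
    have h1 : fac σ a (n + (m + 1) + 1) * (σ ^ m) (fac σ (σ a) n) =
        fac σ a (n + m + 1) * (σ ^ (m + 1)) (fac σ a (n + 1)) := by
      have e1 : n + (m + 1) + 1 = (m + 1) + (n + 1) := by ring
      have e2 : n + m + 1 = (m + 1) + n := by ring
      rw [e1, e2, fac_add σ a (m + 1) (n + 1), fac_add σ a (m + 1) n, ← map_fac, pow_succ,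
        RingAut.mul_apply, RingAut.mul_apply]
      ring
    rw [fac_succ σ _ (m + 1), ih, fac_succ σ _ m]
    linear_combination (-fac σ (fac σ (σ a) n) m) * h1

theorem fac_ne_zero [IsDomain F] {a : F} (ha : a ≠ 0) (n : ℕ) : fac σ a n ≠ 0 :=
  Finset.prod_ne_zero_iff.mpr fun i _ => (map_ne_zero_iff _ (σ ^ i).injective).mpr ha

theorem fac_sq_eq_one {a : F} (ha : a ^ 2 = 1) (n : ℕ) : fac σ a n ^ 2 = 1 := by
  rw [sq, ← fac_mul, ← sq, ha, one_fac]

end Factorial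

/-! ### Orders, leading terms and spans of the left shifts `x^k p`. -/

section Shifts

variable {F : Type*} [CommRing F] {σ : RingAut F} (δ : PseudoDerivation σ)

theorem coeff_mapCoeff (f : F →+ F) (p : F[X]) (n : ℕ) :
    (mapCoeff f p).coeff n = f (p.coeff n) := by
  induction p using Polynomial.induction_on' with
  | add p q hp hq => simp [hp, hq]
  | monomial k a =>
    have h : mapCoeff f (monomial k a) = monomial k (f a) :=
      Polynomial.sum_monomial_index a (fun n a => monomial n (f a)) (by simp)
    rw [h, coeff_monomial, coeff_monomial]
    split_ifs <;> simp

theorem coeff_xMul_succ (p : F[X]) (n : ℕ) :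
    (xMul δ p).coeff (n + 1) = σ (p.coeff n) + δ.toHom (p.coeff (n + 1)) := by
  simp [xMul_apply, coeff_X_mul, coeff_mapCoeff]

theorem natDegree_xMul_le {p : F[X]} {N : ℕ} (h : p.natDegree ≤ N) :
    (xMul δ p).natDegree ≤ N + 1 := by
  rw [natDegree_le_iff_coeff_eq_zero]
  intro m hm
  obtain ⟨m, rfl⟩ := Nat.exists_eq_add_one_of_ne_zero (show m ≠ 0 by omega)
  rw [coeff_xMul_succ, coeff_eq_zero_of_natDegree_lt (by omega),
    coeff_eq_zero_of_natDegree_lt (by omega)]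
  simp

theorem pow_succ_xMul_apply (k : ℕ) (p : F[X]) :
    (xMul δ ^ (k + 1)) p = xMul δ ((xMul δ ^ k) p) := by
  rw [pow_succ']; rfl

theorem natDegree_pow_xMul_le {p : F[X]} {N : ℕ} (h : p.natDegree ≤ N) (k : ℕ) :
    ((xMul δ ^ k) p).natDegree ≤ k + N := by
  induction k with
  | zero => simpa using h
  | succ k ih =>
    rw [pow_succ_xMul_apply]
    exact (natDegree_xMul_le δ ih).trans (by omega)

theorem coeff_pow_xMul {p : F[X]} {N : ℕ} (h : p.natDegree ≤ N) (k : ℕ) :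
    ((xMul δ ^ k) p).coeff (k + N) = (σ ^ k) (p.coeff N) := by
  induction k with
  | zero => simp
  | succ k ih =>
    rw [pow_succ_xMul_apply, show k + 1 + N = k + N + 1 by ring, coeff_xMul_succ, ih,
      coeff_eq_zero_of_natDegree_lt (Nat.lt_succ_of_le (natDegree_pow_xMul_le δ h k)),
      map_zero, add_zero, pow_succ', RingAut.mul_apply]

theorem xMul_smul (a : F) (p : F[X]) :
    xMul δ (a • p) = σ a • xMul δ p + δ.toHom a • p := by
  have := congrArg (fun f => f p) (xMul_mul_cMul δ a)
  simpa [end_mul_apply, end_add_apply, cMul_apply, smul_eq_C_mul] using this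

/-- The span of `p, x p, …, xⁿ⁻¹ p`. -/
def shiftSpan (p : F[X]) (n : ℕ) : Submodule F F[X] :=
  Submodule.span F ((fun i => (xMul δ ^ i) p) '' Set.Iio n)

variable {δ}

theorem pow_xMul_mem_shiftSpan (p : F[X]) {i n : ℕ} (h : i < n) :
    (xMul δ ^ i) p ∈ shiftSpan δ p n :=
  Submodule.subset_span ⟨i, h, rfl⟩

theorem shiftSpan_mono (p : F[X]) {m n : ℕ} (h : m ≤ n) : shiftSpan δ p m ≤ shiftSpan δ p n :=
  Submodule.span_mono (Set.image_mono fun _ hi => lt_of_lt_of_le hi h)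

theorem xMul_mem_shiftSpan {p v : F[X]} {n : ℕ} (h : v ∈ shiftSpan δ p n) :
    xMul δ v ∈ shiftSpan δ p (n + 1) := by
  induction h using Submodule.span_induction with
  | mem v hv =>
    obtain ⟨i, hi, rfl⟩ := hv
    have := pow_xMul_mem_shiftSpan (δ := δ) p (Nat.succ_lt_succ hi)
    rwa [Nat.succ_eq_add_one, pow_succ_xMul_apply] at this
  | zero => simp
  | add u v _ _ hu hv => rw [map_add]; exact add_mem hu hv
  | smul a v hv h =>
    rw [xMul_smul]
    exact add_mem (Submodule.smul_mem _ _ h)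
      (Submodule.smul_mem _ _ (shiftSpan_mono p n.le_succ hv))

/-- Moving a scalar through `x^n` creates only lower powers of `x` besides the leading term. Those
vanish in a wedge with the lower shifts, so the scalar comes out as `σ^n a`. -/
theorem pow_xMul_smul_sub_mem (a : F) (p : F[X]) (n : ℕ) :
    (xMul δ ^ n) (a • p) - (σ ^ n) a • (xMul δ ^ n) p ∈ shiftSpan δ p n := by
  induction n with
  | zero => simp
  | succ n ih =>
    have h := xMul_mem_shiftSpan ih
    rw [map_sub, xMul_smul, ← pow_succ_xMul_apply, ← pow_succ_xMul_apply] at h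
    rw [pow_succ' σ, RingAut.mul_apply]
    have h2 := add_mem h (Submodule.smul_mem _ (δ.toHom ((σ ^ n) a))
      (pow_xMul_mem_shiftSpan (δ := δ) p (Nat.lt_succ_self n)))
    convert h2 using 1
    abel

theorem lMul_eq_sum (q p : F[X]) {n : ℕ} (h : q.natDegree < n) :
    lMul δ q p = ∑ i ∈ Finset.range n, q.coeff i • (xMul δ ^ i) p := by
  have hs := map_sum (AddMonoidHom.mk' (fun q => lMul δ q p)
    (fun q r => by rw [map_add, end_add_apply])) (fun i => monomial i (q.coeff i)) (Finset.range n)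
  rw [← q.as_sum_range' n h] at hs
  refine hs.trans (Finset.sum_congr rfl fun i _ => ?_)
  rw [AddMonoidHom.mk'_apply, lMul_monomial, end_mul_apply, cMul_apply, smul_eq_C_mul]

theorem lMul_mem_shiftSpan (q p : F[X]) {n : ℕ} (h : q.natDegree < n) :
    lMul δ q p ∈ shiftSpan δ p n := by
  rw [lMul_eq_sum q p h]
  exact sum_mem fun i hi => Submodule.smul_mem _ _ (pow_xMul_mem_shiftSpan p (by simpa using hi))

theorem pow_xMul_lMul_mem_shiftSpan (q p : F[X]) {n : ℕ} (k : ℕ) (h : q.natDegree < n) :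
    (xMul δ ^ k) (lMul δ q p) ∈ shiftSpan δ p (k + n) := by
  induction k with
  | zero => simpa using lMul_mem_shiftSpan q p h
  | succ k ih =>
    rw [pow_succ_xMul_apply, add_right_comm]
    exact xMul_mem_shiftSpan ih

theorem coeff_lMul (q p : F[X]) :
    (lMul δ q p).coeff (q.natDegree + p.natDegree) =
      q.leadingCoeff * (σ ^ q.natDegree) p.leadingCoeff := by
  rw [lMul_eq_sum q p (Nat.lt_succ_self _), Finset.sum_range_succ, coeff_add, finsetSum_coeff, Finset.sum_eq_zero, zero_add,
    coeff_smul, coeff_pow_xMul δ le_rfl]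
  · rfl
  · intro i hi
    rw [coeff_smul, smul_eq_mul, coeff_eq_zero_of_natDegree_lt (p := (xMul δ ^ i) p), mul_zero]
    refine (natDegree_pow_xMul_le δ le_rfl i).trans_lt ?_
    have := Finset.mem_range.mp hi
    omega

theorem natDegree_lMul_ge [IsDomain F] {q p : F[X]} (hq : q ≠ 0) (hp : p ≠ 0) :
    q.natDegree + p.natDegree ≤ (lMul δ q p).natDegree := by
  apply le_natDegree_of_ne_zero
  rw [coeff_lMul]
  exact mul_ne_zero (leadingCoeff_ne_zero.mpr hq) 
    ((map_ne_zero_iff _ (σ ^ q.natDegree).injective).mpr (leadingCoeff_ne_zero.mpr hp))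

end Shifts

/-! ### Subresultants in the exterior algebra and their behaviour under division. -/

section Exterior

variable {K : Type*} [Field K] {σ : RingAut K} (δ : PseudoDerivation σ)

/-- The product `x^(n-1) p ∧ ⋯ ∧ x p ∧ p` in the exterior algebra. -/
def shiftProd (p : K[X]) : ℕ → ExteriorAlgebra K K[X]
  | 0 => 1
  | n + 1 => ExteriorAlgebra.ι K ((xMul δ ^ n) p) * shiftProd p n

theorem shiftProd_succ (p : K[X]) (n : ℕ) :
    shiftProd δ p (n + 1) = ExteriorAlgebra.ι K ((xMul δ ^ n) p) * shiftProd δ p n := rfl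

theorem ι_mul_ι (u v : K[X]) : ExteriorAlgebra.ι K u * ExteriorAlgebra.ι K v =
    -(ExteriorAlgebra.ι K v * ExteriorAlgebra.ι K u) :=
  eq_neg_of_add_eq_zero_left (ExteriorAlgebra.ι_add_mul_swap u v)

variable {δ}

theorem ι_mul_shiftProd (u p : K[X]) (n : ℕ) :
    ExteriorAlgebra.ι K u * shiftProd δ p n =
      (-1 : K) ^ n • (shiftProd δ p n * ExteriorAlgebra.ι K u) := by
  induction n with
  | zero => simp [shiftProd]
  | succ n ih =>
    rw [shiftProd_succ, ← mul_assoc, ι_mul_ι, neg_mul, mul_assoc, ih, pow_succ]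
    simp [mul_assoc]

/-- The scalar is `(-1)^(m n)`. Only `u ^ 2 = 1` is recorded, here and later, since signs affect
neither integrality nor divisibility. -/
theorem shiftProd_mul_shiftProd (p q : K[X]) (m n : ℕ) : ∃ u : K, u ^ 2 = 1 ∧
    shiftProd δ p m * shiftProd δ q n = u • (shiftProd δ q n * shiftProd δ p m) := by
  induction m with
  | zero => exact ⟨1, by simp, by simp [shiftProd]⟩
  | succ m ih =>
    obtain ⟨u, hu, h⟩ := ih
    refine ⟨u * (-1) ^ n, by rw [mul_pow, hu, ← pow_mul, mul_comm n, pow_mul]; simp, ?_⟩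
    rw [shiftProd_succ, mul_assoc, h, mul_smul_comm, ← mul_assoc, ι_mul_shiftProd, smul_mul_assoc,
      smul_smul, mul_assoc]

theorem ι_mul_shiftProd_eq_zero {u p : K[X]} {n : ℕ} (h : u ∈ shiftSpan δ p n) :
    ExteriorAlgebra.ι K u * shiftProd δ p n = 0 := by
  induction h using Submodule.span_induction with
  | zero => simp
  | add u v _ _ hu hv => rw [map_add, add_mul, hu, hv, add_zero]
  | smul a u _ hu => rw [map_smul, smul_mul_assoc, hu, smul_zero]
  | mem u hu =>
    obtain ⟨i, hi, rfl⟩ := hu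
    simp only [Set.mem_Iio] at hi
    induction n with
    | zero => omega
    | succ n ih =>
      rw [shiftProd_succ]
      rcases Nat.lt_succ_iff_lt_or_eq.mp hi with h | rfl
      · rw [← mul_assoc, ι_mul_ι, neg_mul, mul_assoc, ih h, mul_zero, neg_zero]
      · rw [← mul_assoc, ExteriorAlgebra.ι_sq_zero, zero_mul]

theorem shiftProd_smul (a : K) (p : K[X]) (n : ℕ) :
    shiftProd δ (a • p) n = fac σ a n • shiftProd δ p n := by
  induction n with
  | zero => simp [shiftProd, fac_zero]
  | succ n ih =>
    have h := ι_mul_shiftProd_eq_zero (pow_xMul_smul_sub_mem (δ := δ) a p n)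
    rw [map_sub, sub_mul, (ExteriorAlgebra.ι K).map_smul, sub_eq_zero] at h
    rw [shiftProd_succ, ih, mul_smul_comm, h, smul_mul_assoc, smul_smul, shiftProd_succ, fac_succ]

/-- For `i < m` the vector `x^i q b` lies in the span of the first `n` shifts of `b`, which the
factor `shiftProd δ b n` annihilates. -/
theorem shiftProd_add_mul {q b w : K[X]} {k m n : ℕ} (hq : q.natDegree < k) (h : k + m ≤ n + 1) :
    shiftProd δ (lMul δ q b + w) m * shiftProd δ b n = shiftProd δ w m * shiftProd δ b n := by
  induction m with
  | zero => rfl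
  | succ m ih =>
    have h0 := ι_mul_shiftProd_eq_zero (shiftSpan_mono b (by omega : m + k ≤ n)
      (pow_xMul_lMul_mem_shiftSpan (δ := δ) q b m hq))
    rw [shiftProd_succ, mul_assoc, ih (by omega), map_add, map_add, add_mul, ← mul_assoc,
      ι_mul_shiftProd, smul_mul_assoc, mul_assoc, h0, mul_zero, smul_zero, zero_add, ← mul_assoc,
      shiftProd_succ]

/-- Interior multiplication by the coefficient functional of `xⁿ`. -/
def coeffContract (n : ℕ) : ExteriorAlgebra K K[X] →ₗ[K] ExteriorAlgebra K K[X] :=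
  CliffordAlgebra.contractLeft (lcoeff K n)

theorem coeffContract_ι_mul (n : ℕ) (v : K[X]) (y : ExteriorAlgebra K K[X]) :
    coeffContract n (ExteriorAlgebra.ι K v * y) =
      v.coeff n • y - ExteriorAlgebra.ι K v * coeffContract n y :=
  CliffordAlgebra.contractLeft_ι_mul _ _ _

theorem coeffContract_one (n : ℕ) : coeffContract n (1 : ExteriorAlgebra K K[X]) = 0 :=
  CliffordAlgebra.contractLeft_one _ _

/-- Successive interior multiplication by the coefficient functionals of `x^(j+n), …, x^(j+1)`. -/
def topContract (j : ℕ) : ℕ → ExteriorAlgebra K K[X] →ₗ[K] ExteriorAlgebra K K[X]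
  | 0 => LinearMap.id
  | n + 1 => topContract j n ∘ₗ coeffContract (j + n + 1)

theorem topContract_succ (j n : ℕ) (y : ExteriorAlgebra K K[X]) :
    topContract j (n + 1) y = topContract j n (coeffContract (j + n + 1) y) := rfl

/-- Contraction is an antiderivation, and every `x^i p` with `i < m` has degree below `n`. -/
theorem coeffContract_shiftProd_mul {p : K[X]} {N m n : ℕ} (hp : p.natDegree ≤ N)
    (h : m + N ≤ n) {y : ExteriorAlgebra K K[X]} (hy : coeffContract n y = 0) :
    coeffContract n (shiftProd δ p m * y) = 0 := by
  induction m with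
  | zero => simpa [shiftProd] using hy
  | succ m ih =>
    rw [shiftProd_succ, mul_assoc, coeffContract_ι_mul, ih (by omega), mul_zero,
      coeff_eq_zero_of_natDegree_lt, zero_smul, sub_zero]
    exact (natDegree_pow_xMul_le δ hp m).trans_lt (by omega)

theorem coeffContract_shiftProd {p : K[X]} {N m n : ℕ} (hp : p.natDegree ≤ N)
    (h : m + N ≤ n) : coeffContract n (shiftProd δ p m) = 0 := by
  simpa using coeffContract_shiftProd_mul (δ := δ) hp h (coeffContract_one n)

/-- A block triangular determinant: the leading row of `b` is the only one reaching the current top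
degree, so each contraction removes it at the cost of a shifted leading coefficient. -/
theorem topContract_shiftProd_mul {b r : K[X]} {j s q : ℕ} (hs : 1 ≤ s)
    (hb : b.natDegree = j + s) (hr : r.natDegree ≤ q + j) (k : ℕ) :
    topContract j (q + k + s - 1) (shiftProd δ b (q + k) * shiftProd δ r s) =
      fac σ ((σ ^ q) b.leadingCoeff) k •
        topContract j (q + s - 1) (shiftProd δ b q * shiftProd δ r s) := by
  induction k with
  | zero => simp [fac_zero]
  | succ k ih =>
    have e : q + (k + 1) + s - 1 = (q + k + s - 1) + 1 := by omega
    have e2 : j + (q + k + s - 1) + 1 = q + k + (j + s) := by omega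
    rw [e, topContract_succ, e2, ← add_assoc q k 1, shiftProd_succ, mul_assoc, coeffContract_ι_mul,
      coeff_pow_xMul δ hb.le, coeffContract_shiftProd_mul hb.le le_rfl
        (coeffContract_shiftProd hr (by omega)), mul_zero, sub_zero, map_smul, ih, smul_smul,
      fac_succ, leadingCoeff, ← hb, ← RingAut.mul_apply, ← pow_add, mul_comm, add_comm k q]

/-- The polynomial subresultant of index `j` of `a` and `b`, as an element of degree one of the
exterior algebra. -/
def subres (δ : PseudoDerivation σ) (j : ℕ) (a b : K[X]) : ExteriorAlgebra K K[X] :=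
  topContract j (b.natDegree - j + (a.natDegree - j) - 1)
    (shiftProd δ a (b.natDegree - j) * shiftProd δ b (a.natDegree - j))

/-- Reduction of a shift product modulo one division step. -/
theorem fac_smul_shiftProd_mul {a b r q : K[X]} {α β : K} (hab : b.natDegree ≤ a.natDegree)
    (hb : b ≠ 0) (hr : r.natDegree ≤ b.natDegree) (h : α • a = lMul δ q b + β • r) {j : ℕ}
    (hj : j < b.natDegree) : ∃ u : K, u ^ 2 = 1 ∧
    fac σ α (b.natDegree - j) •
        (shiftProd δ a (b.natDegree - j) * shiftProd δ b (a.natDegree - j)) =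
      (u * fac σ β (b.natDegree - j)) •
        (shiftProd δ b (a.natDegree - j) * shiftProd δ r (b.natDegree - j)) := by
  have hq : q.natDegree ≤ a.natDegree - b.natDegree := by
    rcases eq_or_ne q 0 with rfl | hq
    · simp
    have h1 := natDegree_lMul_ge (δ := δ) hq hb
    rw [eq_sub_of_add_eq h.symm] at h1
    have h2 := (natDegree_sub_le _ _).trans
      (max_le_max (natDegree_smul_le α a) (natDegree_smul_le β r))
    rcases le_max_iff.mp (h1.trans h2) with h | h <;> omega
  obtain ⟨u, hu, hc⟩ := shiftProd_mul_shiftProd (δ := δ) r b (b.natDegree - j) (a.natDegree - j)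
  refine ⟨u, hu, ?_⟩
  rw [← smul_mul_assoc, ← shiftProd_smul, h,
    shiftProd_add_mul (Nat.lt_succ_of_le hq) (by omega), shiftProd_smul, smul_mul_assoc, hc,
    smul_smul, mul_comm]

/-- After the reduction there are `a.natDegree - j` rows of `b`, while the subresultant of `b` and
`r` uses `r.natDegree - j`; the surplus rows yield the last factor. -/
theorem fac_smul_subres {a b r q : K[X]} {α β : K} (hab : b.natDegree ≤ a.natDegree)
    (hb : b ≠ 0) (hr : r.natDegree ≤ b.natDegree) (h : α • a = lMul δ q b + β • r) {j : ℕ}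
    (hj : j < r.natDegree) : ∃ u : K, u ^ 2 = 1 ∧
    fac σ α (b.natDegree - j) • subres δ j a b =
      (u * fac σ β (b.natDegree - j) *
        (σ ^ (r.natDegree - j)) (fac σ b.leadingCoeff (a.natDegree - r.natDegree))) •
        subres δ j b r := by
  obtain ⟨u, hu, hc⟩ := fac_smul_shiftProd_mul hab hb hr h (hj.trans_le hr)
  refine ⟨u, hu, ?_⟩
  have h1 := topContract_shiftProd_mul (δ := δ) (b := b) (r := r) (j := j) (s := b.natDegree - j)
    (q := r.natDegree - j) (by omega) (by omega) (by omega) (a.natDegree - r.natDegree)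
  rw [show r.natDegree - j + (a.natDegree - r.natDegree) = a.natDegree - j by omega] at h1
  rw [subres, ← map_smul, hc, map_smul, add_comm (b.natDegree - j), h1, smul_smul, pow_fac, subres]

/-- At this index a single row of `r` remains and all rows of `b` contract away. The drop in order
from `b` to `r` may be arbitrary, which covers non-normal sequences. -/
theorem smul_subres_pred {a b r q : K[X]} {α β : K} (hab : b.natDegree ≤ a.natDegree)
    (hb : b ≠ 0) (hr : r.natDegree < b.natDegree) (h : α • a = lMul δ q b + β • r) :
    ∃ u : K, u ^ 2 = 1 ∧ α • subres δ (b.natDegree - 1) a b =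
      (u * β * fac σ b.leadingCoeff (a.natDegree - b.natDegree + 1)) •
        ExteriorAlgebra.ι K r := by
  obtain ⟨u, hu, hc⟩ := fac_smul_shiftProd_mul hab hb hr.le h (show b.natDegree - 1 < _ by omega)
  refine ⟨u, hu, ?_⟩
  have h1 := topContract_shiftProd_mul (δ := δ) (b := b) (r := r) (j := b.natDegree - 1) (s := 1)
    (q := 0) le_rfl (by omega) (by omega) (a.natDegree - b.natDegree + 1)
  have e1 : b.natDegree - (b.natDegree - 1) = 1 := by omega
  have e2 : a.natDegree - (b.natDegree - 1) = a.natDegree - b.natDegree + 1 := by omega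
  rw [e1, e2, fac_one, fac_one] at hc
  rw [subres, e1, e2, ← map_smul, hc, map_smul, add_comm 1]
  rw [zero_add] at h1
  rw [h1, smul_smul]
  simp [topContract, shiftProd]

end Exterior

/-! ### The terms of the sequence as subresultants of `A` and `B`. -/

section Sequence

variable {K : Type*} [Field K] {σ : RingAut K}

theorem sigmaFactorial_natCast (a : K) (n : ℕ) : sigmaFactorial σ a n = fac σ a n := rfl

theorem sigmaFactorial_ne_zero {a : K} (ha : a ≠ 0) (n : ℤ) : sigmaFactorial σ a n ≠ 0 := by
  cases n with
  | ofNat n => exact fac_ne_zero σ ha n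
  | negSucc n =>
    exact inv_ne_zero (Finset.prod_ne_zero_iff.mpr fun i _ =>
      (map_ne_zero_iff _ (σ ^ (-((i : ℤ) + 1))).injective).mpr ha)

theorem sigmaFactorial_neg_one_sq (n : ℤ) : sigmaFactorial σ (-1) n ^ 2 = 1 := by
  cases n with
  | ofNat n => exact fac_sq_eq_one σ (by simp) n
  | negSucc n =>
    simp only [sigmaFactorial, map_neg, map_one, inv_pow, ← Finset.prod_pow, even_two.neg_one_pow,
      Finset.prod_const_one, inv_one]

theorem fac_neg (a : K) (n : ℕ) : fac σ (-a) n = fac σ (-1) n * fac σ a n := by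
  rw [← fac_mul, neg_one_mul]

variable {δ : PseudoDerivation σ}

theorem lc_ne_zero {A : OrePoly δ} (h : A ≠ 0) : A.lc ≠ 0 :=
  leadingCoeff_ne_zero.mpr fun h' => h (OrePoly.toPoly.injective (h'.trans (map_zero _).symm))

theorem toPoly_C_mul (a : K) (A : OrePoly δ) :
    OrePoly.toPoly (OrePoly.C a * A) = a • OrePoly.toPoly A := by
  rw [OrePoly.toPoly_mul, OrePoly.C, AddEquiv.apply_symm_apply, ← monomial_zero_left,
    lMul_monomial, pow_zero, mul_one, cMul_apply, smul_eq_C_mul]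

variable {A B : OrePoly δ} {ℓ : ℕ} {R Q : ℕ → OrePoly δ}

theorem sresPsi_ne_zero (h : ∀ i, i ≤ ℓ → R i ≠ 0) : ∀ i, i ≤ ℓ + 1 → sresPsi R i ≠ 0
  | 0, _ => by simp [sresPsi]
  | 1, _ => by simp [sresPsi]
  | i + 2, hi => by
    rw [sresPsi]
    refine div_ne_zero (sigmaFactorial_ne_zero (neg_ne_zero.mpr (lc_ne_zero (h _ (by omega)))) _)
      (sigmaFactorial_ne_zero ?_ _)
    exact (map_ne_zero_iff _ σ.injective).mpr (sresPsi_ne_zero h (i + 1) (by omega))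

theorem IsPRS.order_lt {α β : ℕ → K} (h : IsPRS A B ℓ R Q α β) {i : ℕ} (h1 : 1 ≤ i)
    (hi : i + 1 ≤ ℓ) : (R (i + 1)).order < (R i).order := by
  refine natDegree_lt_natDegree (fun h' => h.ne_zero (i + 1) hi ?_) (h.degree_lt i h1 (by omega))
  exact OrePoly.toPoly.injective (h'.trans (map_zero _).symm)

theorem IsPRS.order_le {α β : ℕ → K} (h : IsPRS A B ℓ R Q α β) (hAB : B.order ≤ A.order) {i : ℕ}
    (hi : i + 1 ≤ ℓ) : (R (i + 1)).order ≤ (R i).order := by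
  rcases Nat.eq_zero_or_pos i with rfl | h1
  · rw [h.zero, h.one]; exact hAB
  · exact (h.order_lt h1 hi).le

theorem orderDiff_eq {i : ℕ} (h : (R (i + 1)).order ≤ (R i).order) :
    orderDiff R i = (((R i).order - (R (i + 1)).order : ℕ) : ℤ) := by
  rw [orderDiff, Nat.cast_sub h]

theorem sresAlpha_eq {i : ℕ} (h : (R (i + 1)).order ≤ (R i).order) :
    sresAlpha R (i + 1) = fac σ (R (i + 1)).lc ((R i).order - (R (i + 1)).order + 1) := by
  rw [sresAlpha, Nat.add_sub_cancel, orderDiff_eq h, ← sigmaFactorial_natCast]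
  rfl

/-- The factor of `sresBeta` besides the power of `ψ`. -/
def sresLead (R : ℕ → OrePoly δ) (i : ℕ) : K := if i = 0 then 1 else (R i).lc

theorem sresLead_ne_zero (h : ∀ i, i ≤ ℓ → R i ≠ 0) {i : ℕ} (hi : i ≤ ℓ) : sresLead R i ≠ 0 := by
  rw [sresLead]
  split_ifs
  · exact one_ne_zero
  · exact lc_ne_zero (h i hi)

theorem sresBeta_eq {i : ℕ} (h : (R (i + 1)).order ≤ (R i).order) :
    sresBeta R (i + 1) = -(sresLead R i *
      fac σ (σ (sresPsi R (i + 1))) ((R i).order - (R (i + 1)).order)) := by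
  rw [sresBeta, sresLead, Nat.add_sub_cancel, orderDiff_eq h, sigmaFactorial_natCast]
  rcases Nat.eq_zero_or_pos i with rfl | h1
  · rw [if_pos rfl, if_pos rfl, one_mul, zero_add, orderDiff_eq h, sigmaFactorial_natCast]
  · rw [if_neg (by omega), if_neg (by omega), neg_mul]

/-- The recursion for `ψ`, with products of `σ`-factorials. -/
theorem fac_fac_mul_fac_sresPsi {α β : ℕ → K} (h : IsPRS A B ℓ R Q α β)
    (hAB : B.order ≤ A.order) {i : ℕ} (hi : i + 1 ≤ ℓ) (m : ℕ) : ∃ u : K, u ^ 2 = 1 ∧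
    fac σ (fac σ (σ (sresPsi R (i + 1))) ((R i).order - (R (i + 1)).order)) (m + 1) *
        fac σ (σ (sresPsi R (i + 2))) m =
      u * (fac σ (σ (sresPsi R (i + 1))) ((R i).order - (R (i + 1)).order + m) *
        fac σ (fac σ (σ (R (i + 1)).lc) ((R i).order - (R (i + 1)).order)) m) := by
  have hle := h.order_le hAB hi
  have hψ : sresPsi R (i + 2) = _ := sresPsi.eq_3 R i
  rw [orderDiff_eq hle, sigmaFactorial_natCast, fac_neg] at hψ
  have hp : sresPsi R (i + 1) ≠ 0 := sresPsi_ne_zero h.ne_zero _ (by omega)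
  have hsq : ∀ n, fac σ (-1 : K) n ^ 2 = 1 := fac_sq_eq_one σ (by simp)
  generalize hn : (R i).order - (R (i + 1)).order = n at *
  rcases n with _ | n
  -- Equal consecutive orders can occur only for `A` and `B`. Then the denominator of `ψ_2` has
  -- exponent `-1`, but `ψ_1 = -1`, so every factor involved squares to one.
  · have h0 : i = 0 := by
      by_contra h0
      have := h.order_lt (Nat.pos_of_ne_zero h0) hi
      omega
    subst h0
    have e : sresPsi R (0 + 1) = -1 := rfl
    rw [e, map_neg, map_one] at hψ ⊢
    simp only [fac_zero, mul_one] at hψ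
    have h2 : (σ (sresPsi R (0 + 2))) ^ 2 = 1 := by
      rw [hψ, ← map_pow, div_pow, one_pow, sigmaFactorial_neg_one_sq, div_one, map_one]
    refine ⟨fac σ (σ (sresPsi R (0 + 2))) m * fac σ (-1) (0 + m), ?_, ?_⟩
    · rw [mul_pow, hsq, fac_sq_eq_one σ h2, one_mul]
    · rw [fac_zero, fac_zero, one_fac, one_fac, mul_one, one_mul, mul_assoc, ← sq, hsq, mul_one]
  · have e : ((n + 1 : ℕ) : ℤ) - 1 = n := by push_cast; ring
    rw [e, sigmaFactorial_natCast] at hψ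
    have hσp : σ (sresPsi R (i + 1)) ≠ 0 := (map_ne_zero_iff _ σ.injective).mpr hp
    have h1 := (eq_div_iff (fac_ne_zero σ hσp n)).mp hψ
    -- This is the recursion for `ψ`, cleared of its denominator; `fac_fac` supplies the missing
    -- hook factor.
    have h2 := congrArg (fun x => fac σ (σ x) m) h1
    simp only [map_mul, fac_mul, map_fac, map_neg, map_one] at h2
    refine ⟨fac σ (fac σ (-1) (n + 1)) m, fac_sq_eq_one σ (hsq _) m, ?_⟩
    rw [fac_fac, show n + 1 + m = n + m + 1 by ring]
    linear_combination fac σ (σ (sresPsi R (i + 1))) (n + m + 1) * h2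

theorem IsPRS.rem_toPoly {α β : ℕ → K} (h : IsPRS A B ℓ R Q α β) {i : ℕ} (hi : i + 1 ≤ ℓ) :
    α (i + 1) • OrePoly.toPoly (R i) = lMul δ (OrePoly.toPoly (Q (i + 1)))
      (OrePoly.toPoly (R (i + 1))) + β (i + 1) • OrePoly.toPoly (R (i + 2)) := by
  have := congrArg OrePoly.toPoly (h.rem (i + 1) (by omega) hi)
  rwa [map_add, toPoly_C_mul, toPoly_C_mul, OrePoly.toPoly_mul] at this

theorem toPoly_ne_zero {A : OrePoly δ} (h : A ≠ 0) : OrePoly.toPoly A ≠ 0 :=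
  fun h' => h (OrePoly.toPoly.injective (h'.trans (map_zero _).symm))

/-- The subresultants of `A` and `B` against those of consecutive terms of the sequence. -/
theorem smul_subres_eq (h : IsPRS A B ℓ R Q (sresAlpha R) (sresBeta R)) (hAB : B.order ≤ A.order)
    (j : ℕ) {i : ℕ} (hi : i + 1 ≤ ℓ) (hj : j < (R (i + 1)).order) : ∃ u : K, u ^ 2 = 1 ∧
    (fac σ (sresLead R i) ((R (i + 1)).order - j) *
        fac σ (σ (sresPsi R (i + 1))) ((R i).order - j - 1)) •
        subres δ j (OrePoly.toPoly A) (OrePoly.toPoly B) =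
      u • subres δ j (OrePoly.toPoly (R i)) (OrePoly.toPoly (R (i + 1))) := by
  induction i with
  | zero =>
    refine ⟨fac σ (-1) ((R 0).order - j - 1), fac_sq_eq_one σ (by simp) _, ?_⟩
    simp only [sresLead, if_true, one_fac, one_mul, sresPsi, map_neg, map_one, zero_add, h.zero,
      h.one]
  | succ i ih =>
    have hlt := h.order_lt (i := i + 1) (by omega) hi
    have hle := h.order_le hAB (i := i) (by omega)
    obtain ⟨u₀, hu₀, h₀⟩ := ih (by omega) (hj.trans hlt)
    obtain ⟨u₁, hu₁, h₁⟩ := fac_smul_subres (δ := δ) (j := j) hle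
      (toPoly_ne_zero (h.ne_zero (i + 1) (by omega))) hlt.le (h.rem_toPoly (i := i) (by omega)) hj
    change fac σ _ ((R (i + 1)).order - j) • _ =
      (u₁ * fac σ _ ((R (i + 1)).order - j) * (σ ^ ((R (i + 1 + 1)).order - j))
        (fac σ (R (i + 1)).lc ((R i).order - (R (i + 1 + 1)).order))) • _ at h₁
    obtain ⟨m, hm⟩ := Nat.exists_eq_add_of_le' (show 1 ≤ (R (i + 1)).order - j by omega)
    obtain ⟨u₃, hu₃, h₃⟩ := fac_fac_mul_fac_sresPsi h hAB (i := i) (by omega) m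
    have hne := h.ne_zero
    have hlc : (R (i + 1)).lc ≠ 0 := lc_ne_zero (hne _ (by omega))
    have hL := fac_ne_zero σ (sresLead_ne_zero hne (i := i) (by omega)) (m + 1)
    have hP := fac_ne_zero σ ((map_ne_zero_iff _ σ.injective).mpr
      (sresPsi_ne_zero hne (i + 1) (by omega))) ((R i).order - (R (i + 1)).order + m)
    have hH := fac_ne_zero σ (fac_ne_zero σ ((map_ne_zero_iff _ σ.injective).mpr hlc)
      ((R i).order - (R (i + 1)).order)) m
    have hT : (σ ^ ((R (i + 1 + 1)).order - j))
        (fac σ (R (i + 1)).lc ((R i).order - (R (i + 1 + 1)).order)) ≠ 0 :=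
      (map_ne_zero_iff _ (σ ^ _).injective).mpr (fac_ne_zero σ hlc _)
    -- The hook part of the factorial of `α` splits in two: the power of `lc (R (i + 1))` wanted at
    -- the next stage, and the factor produced by the surplus rows, which cancels.
    have hET : fac σ (R (i + 1)).lc ((R i).order - (R (i + 1)).order + m + 1) =
        fac σ (R (i + 1)).lc ((R (i + 1 + 1)).order - j) * (σ ^ ((R (i + 1 + 1)).order - j))
        (fac σ (R (i + 1)).lc ((R i).order - (R (i + 1 + 1)).order)) := by
      rw [← fac_add]; congr 1; omega
    rw [hm, sresAlpha_eq hle, fac_fac, hET, sresBeta_eq hle, fac_neg, fac_mul] at h₁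
    rw [hm, show (R i).order - j - 1 = (R i).order - (R (i + 1)).order + m by omega] at h₀
    rw [show (R (i + 1)).order - j - 1 = m by omega, show sresLead R (i + 1) = (R (i + 1)).lc from
      if_neg (by omega)]
    refine ⟨u₀ * u₁ * fac σ (-1) (m + 1) * u₃, ?_, ?_⟩
    · simp only [mul_pow, hu₀, hu₁, hu₃, fac_sq_eq_one σ (show (-1 : K) ^ 2 = 1 by simp), mul_one]
    generalize subres δ j (OrePoly.toPoly A) (OrePoly.toPoly B) = S at *
    generalize subres δ j (OrePoly.toPoly (R i)) (OrePoly.toPoly (R (i + 1))) = S₁ at *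
    generalize subres δ j (OrePoly.toPoly (R (i + 1))) (OrePoly.toPoly (R (i + 1 + 1))) = S₂ at *
    refine smul_right_injective _ (mul_ne_zero (mul_ne_zero hL hP) (mul_ne_zero hT hH)) ?_
    beta_reduce
    linear_combination (norm := module) (fac σ (σ (sresPsi R (i + 2))) m *
      (fac σ (R (i + 1)).lc ((R (i + 1 + 1)).order - j) * (σ ^ ((R (i + 1 + 1)).order - j))
        (fac σ (R (i + 1)).lc ((R i).order - (R (i + 1 + 1)).order)) *
        fac σ (fac σ (σ (R (i + 1)).lc) ((R i).order - (R (i + 1)).order)) m)) • h₀ +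
      (u₀ * fac σ (σ (sresPsi R (i + 2))) m) • h₁ +
      ((u₀ * u₁ * fac σ (-1) (m + 1) * fac σ (sresLead R i) (m + 1) *
        (σ ^ ((R (i + 1 + 1)).order - j))
        (fac σ (R (i + 1)).lc ((R i).order - (R (i + 1 + 1)).order))) * h₃) • S₂

/-- The terms of the subresultant sequence are subresultants, up to sign. -/
theorem subres_eq_smul_ι (h : IsPRS A B ℓ R Q (sresAlpha R) (sresBeta R))
    (hAB : B.order ≤ A.order) {i : ℕ} (hi : i + 2 ≤ ℓ) : ∃ u : K, u ^ 2 = 1 ∧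
    subres δ ((R (i + 1)).order - 1) (OrePoly.toPoly A) (OrePoly.toPoly B) =
      u • ExteriorAlgebra.ι K (OrePoly.toPoly (R (i + 2))) := by
  have hlt := h.order_lt (i := i + 1) (by omega) hi
  have hle := h.order_le hAB (i := i) (by omega)
  obtain ⟨u₀, hu₀, h₀⟩ := smul_subres_eq h hAB ((R (i + 1)).order - 1) (i := i) (by omega)
    (by omega)
  obtain ⟨u₁, hu₁, h₁⟩ := smul_subres_pred (δ := δ) hle
      (toPoly_ne_zero (h.ne_zero (i + 1) (by omega))) hlt (h.rem_toPoly (i := i) (by omega))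
  change _ • subres δ ((R (i + 1)).order - 1) _ _ = (u₁ * _ *
    fac σ (R (i + 1)).lc ((R i).order - (R (i + 1)).order + 1)) • _ at h₁
  have hne := h.ne_zero
  have hα := fac_ne_zero σ (lc_ne_zero (hne (i + 1) (by omega)))
    ((R i).order - (R (i + 1)).order + 1)
  have hL := sresLead_ne_zero hne (i := i) (by omega)
  have hP := fac_ne_zero σ ((map_ne_zero_iff _ σ.injective).mpr
      (sresPsi_ne_zero hne (i + 1) (by omega))) ((R i).order - (R (i + 1)).order)
  -- Here `α_(i+1)` equals the leading coefficient factor on the right, and the coefficient of the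
  -- subresultant in `h₀` is `-β_(i+1)`, so only a sign survives.
  rw [sresAlpha_eq hle, sresBeta_eq hle] at h₁
  rw [show (R (i + 1)).order - ((R (i + 1)).order - 1) = 1 by omega, fac_one,
    show (R i).order - ((R (i + 1)).order - 1) - 1 = (R i).order - (R (i + 1)).order by omega] at h₀
  refine ⟨-(u₀ * u₁), by simp [mul_pow, hu₀, hu₁], ?_⟩
  generalize subres δ ((R (i + 1)).order - 1) (OrePoly.toPoly A) (OrePoly.toPoly B) = S at *
  generalize subres δ _ (OrePoly.toPoly (R i)) (OrePoly.toPoly (R (i + 1))) = S₁ at *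
  refine smul_right_injective _ (mul_ne_zero (mul_ne_zero hL hP) hα) ?_
  beta_reduce
  linear_combination (norm := module) (fac σ (R (i + 1)).lc ((R i).order - (R (i + 1)).order + 1)) • h₀ +
    u₀ • h₁

end Sequence

/-! ### Subresultants over `D` and their common factor. -/

section Integrality

variable {D : Type*} [CommRing D] {K : Type*} [Field K] [Algebra D K]

variable (D K) in
/-- The map `p ↦ ι p` from polynomials over `D` to the exterior algebra over `K`. -/
def intι : D[X] →ₗ[D] ExteriorAlgebra K K[X] :=
  (ExteriorAlgebra.ι K).restrictScalars D ∘ₗ (mapAlgHom (Algebra.ofId D K)).toLinearMap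

theorem intι_apply (p : D[X]) :
    intι D K p = ExteriorAlgebra.ι K (p.map (algebraMap D K)) := rfl

/-- The powers of the range of `intι` are the `D`-spans of products of polynomials over `D`; the
antiderivation rule uses only coefficients of these, which lie in `D`. -/
theorem coeffContract_mem {n : ℕ} (k : ℕ) {y : ExteriorAlgebra K K[X]}
    (hy : y ∈ LinearMap.range (intι D K) ^ (n + 1)) :
    coeffContract k y ∈ LinearMap.range (intι D K) ^ n := by
  induction n generalizing y with
  | zero =>
    rw [zero_add, pow_one] at hy
    obtain ⟨p, rfl⟩ := hy
    rw [intι_apply, ← mul_one (ExteriorAlgebra.ι K _), coeffContract_ι_mul, coeffContract_one,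
      mul_zero, sub_zero, coeff_map, algebraMap_smul, pow_zero]
    exact Submodule.smul_mem _ _ (Submodule.one_le.mp le_rfl)
  | succ n ih =>
    rw [pow_succ'] at hy
    induction hy using Submodule.mul_induction_on' with
    | add x _ y _ hx hy => rw [map_add]; exact add_mem hx hy
    | mem_mul_mem x hx y hy =>
      obtain ⟨p, rfl⟩ := hx
      rw [intι_apply, coeffContract_ι_mul, coeff_map, algebraMap_smul]
      refine sub_mem (Submodule.smul_mem _ _ hy) ?_
      rw [pow_succ']
      exact Submodule.mul_mem_mul ⟨p, rfl⟩ (ih hy)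

theorem topContract_mem (j n k : ℕ) {y : ExteriorAlgebra K K[X]}
    (hy : y ∈ LinearMap.range (intι D K) ^ (k + n)) :
    topContract j n y ∈ LinearMap.range (intι D K) ^ k := by
  induction n generalizing y with
  | zero => exact hy
  | succ n ih => exact ih (coeffContract_mem _ hy)

variable [IsDomain D] [IsFractionRing D K] {σ : RingAut D} (δ : PseudoDerivation σ)

theorem fracDer_algebraMap (a : D) :
    (fracDer K δ).toHom (algebraMap D K a) = algebraMap D K (δ.toHom a) := by
  have h := fracDer_div K δ a 1 one_ne_zero
  simpa [δ.map_one] using h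

theorem xMul_map (p : D[X]) :
    xMul (fracDer K δ) (p.map (algebraMap D K)) = (xMul δ p).map (algebraMap D K) := by
  ext n
  rw [coeff_map]
  cases n with
  | zero => simp [xMul_apply, coeff_mapCoeff, fracDer_algebraMap]
  | succ n =>
    rw [coeff_xMul_succ, coeff_xMul_succ, coeff_map, coeff_map, fracAut_algebraMap,
      fracDer_algebraMap, map_add]

theorem pow_xMul_map (p : D[X]) (n : ℕ) :
    (xMul (fracDer K δ) ^ n) (p.map (algebraMap D K)) =
      ((xMul δ ^ n) p).map (algebraMap D K) := by
  induction n with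
  | zero => rfl
  | succ n ih => rw [pow_succ_xMul_apply, ih, xMul_map, ← pow_succ_xMul_apply]

theorem shiftProd_map_mem (p : D[X]) (n : ℕ) :
    shiftProd (fracDer K δ) (p.map (algebraMap D K)) n ∈ LinearMap.range (intι D K) ^ n := by
  induction n with
  | zero => exact (Submodule.one_le.mp le_rfl)
  | succ n ih =>
    rw [shiftProd_succ, pow_xMul_map, ← intι_apply, pow_succ']
    exact Submodule.mul_mem_mul ⟨_, rfl⟩ ih

/-- The first two rows of the subresultant give a common factor. -/
theorem exists_coeffContract_eq_smul (a b : D[X]) {g : D} {m n : ℕ}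
    (hmn : m + a.natDegree = n + b.natDegree) (ha : g ∣ (σ ^ m) a.leadingCoeff)
    (hb : g ∣ (σ ^ n) b.leadingCoeff) :
    ∃ y ∈ LinearMap.range (intι D K) ^ (m + n + 1),
      coeffContract (m + a.natDegree)
        (shiftProd (fracDer K δ) (a.map (algebraMap D K)) (m + 1) *
          shiftProd (fracDer K δ) (b.map (algebraMap D K)) (n + 1)) = g • y := by
  obtain ⟨x, hx⟩ := ha
  obtain ⟨z, hz⟩ := hb
  have hda : (a.map (algebraMap D K)).natDegree ≤ a.natDegree := natDegree_map_le
  have hdb : (b.map (algebraMap D K)).natDegree ≤ b.natDegree := natDegree_map_le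
  have ea : ((xMul δ ^ m) a).coeff (m + a.natDegree) = g * x := by
    rw [coeff_pow_xMul δ le_rfl, ← hx]; rfl
  have eb : ((xMul δ ^ n) b).coeff (m + a.natDegree) = g * z := by
    rw [hmn, coeff_pow_xMul δ le_rfl, ← hz]; rfl
  have hs : ((-1 : K) ^ m) * (-1) ^ m = 1 := by rw [← mul_pow]; simp
  have hc : shiftProd (fracDer K δ) (a.map (algebraMap D K)) m *
      shiftProd (fracDer K δ) (b.map (algebraMap D K)) (n + 1) =
      (-1 : D) ^ m • (intι D K ((xMul δ ^ n) b) *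
        (shiftProd (fracDer K δ) (a.map (algebraMap D K)) m *
          shiftProd (fracDer K δ) (b.map (algebraMap D K)) n)) := by
    rw [intι_apply, ← mul_assoc, ι_mul_shiftProd, ← algebraMap_smul K, map_pow, map_neg, map_one,
      smul_mul_assoc, smul_smul, hs, one_smul, shiftProd_succ, pow_xMul_map, mul_assoc]
  have h0 : coeffContract (m + a.natDegree)
      (shiftProd (fracDer K δ) (a.map (algebraMap D K)) m *
        shiftProd (fracDer K δ) (b.map (algebraMap D K)) n) = 0 :=
    coeffContract_shiftProd_mul hda le_rfl (coeffContract_shiftProd hdb hmn.ge)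
  -- Laplace expansion along the top degree, divided by `g`: only `x^m a` and `x^n b` reach that
  -- degree, with entries `g * x` and `g * z`. The sign comes from moving `x^n b` past `m` rows.
  refine ⟨x • (shiftProd (fracDer K δ) (a.map (algebraMap D K)) m *
      shiftProd (fracDer K δ) (b.map (algebraMap D K)) (n + 1)) -
    ((-1) ^ m * z) • (intι D K ((xMul δ ^ m) a) *
      (shiftProd (fracDer K δ) (a.map (algebraMap D K)) m *
          shiftProd (fracDer K δ) (b.map (algebraMap D K)) n)), ?_, ?_⟩
  · refine sub_mem (Submodule.smul_mem _ _ ?_) (Submodule.smul_mem _ _ ?_)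
    · rw [add_assoc, pow_add]
      exact Submodule.mul_mem_mul (shiftProd_map_mem δ a m) (shiftProd_map_mem δ b _)
    · rw [pow_succ', pow_add]
      exact Submodule.mul_mem_mul ⟨_, rfl⟩
        (Submodule.mul_mem_mul (shiftProd_map_mem δ a m) (shiftProd_map_mem δ b n))
  · have h1 : coeffContract (m + a.natDegree)
        (shiftProd (fracDer K δ) (a.map (algebraMap D K)) m *
          shiftProd (fracDer K δ) (b.map (algebraMap D K)) (n + 1)) =
        ((-1 : D) ^ m * (g * z)) • (shiftProd (fracDer K δ) (a.map (algebraMap D K)) m *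
          shiftProd (fracDer K δ) (b.map (algebraMap D K)) n) := by
      rw [hc, ← algebraMap_smul K ((-1 : D) ^ m), map_smul, intι_apply, coeffContract_ι_mul, h0,
        mul_zero, sub_zero, coeff_map, eb, algebraMap_smul, algebraMap_smul, smul_smul]
    rw [shiftProd_succ, mul_assoc, coeffContract_ι_mul, h1, pow_xMul_map, coeff_map, ea,
      algebraMap_smul, ← intι_apply, mul_smul_comm, smul_sub, smul_smul, smul_smul]
    congr 2
    ring

/-- A subresultant of operators over `D` comes from an operator over `D`, with a common factor. -/
theorem exists_subres_map_eq (a b : D[X]) {g : D} {j : ℕ} (hja : j < a.natDegree)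
    (hjb : j < b.natDegree) (ha : g ∣ (σ ^ (b.natDegree - j - 1)) a.leadingCoeff)
    (hb : g ∣ (σ ^ (a.natDegree - j - 1)) b.leadingCoeff) :
    ∃ p : D[X], subres (fracDer K δ) j (a.map (algebraMap D K)) (b.map (algebraMap D K)) =
      ExteriorAlgebra.ι K ((g • p).map (algebraMap D K)) := by
  obtain ⟨m, hm⟩ := Nat.exists_eq_add_of_le' (show 1 ≤ b.natDegree - j by omega)
  obtain ⟨n, hn⟩ := Nat.exists_eq_add_of_le' (show 1 ≤ a.natDegree - j by omega)
  rw [hm, Nat.add_sub_cancel] at ha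
  rw [hn, Nat.add_sub_cancel] at hb
  obtain ⟨y, hy, h⟩ := exists_coeffContract_eq_smul (K := K) δ a b (g := g) (m := m) (n := n)
    (by omega) ha hb
  have hinj := IsFractionRing.injective D K
  -- The remaining `m + n` contractions preserve integrality and end in degree one, that is, at a
  -- polynomial over `D`.
  have h1 := topContract_mem j (m + n) 1 (y := y) (by rwa [add_comm 1])
  rw [pow_one] at h1
  obtain ⟨p, hp⟩ := h1
  refine ⟨p, ?_⟩
  rw [subres, natDegree_map_eq_of_injective hinj, natDegree_map_eq_of_injective hinj, hm, hn,
    show m + 1 + (n + 1) - 1 = m + n + 1 by omega, topContract_succ,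
    show j + (m + n) + 1 = m + a.natDegree by omega, h, ← intι_apply, (intι D K).map_smul,
    hp, ← algebraMap_smul K g y, map_smul, algebraMap_smul]

end Integrality

/-! ### Divisibility of the content and the conclusion. -/

theorem dvd_content_smul {D : Type*} [EuclideanDomain D] {σ : RingAut D} {δ : PseudoDerivation σ}
    (g : D) (p : D[X]) : g ∣ content (OrePoly.toPoly.symm (g • p) : OrePoly δ) := by
  rw [content]
  split_ifs
  · refine ⟨p.leadingCoeff, ?_⟩
    change (g • p).leadingCoeff = _
    rw [smul_eq_C_mul, leadingCoeff_mul, leadingCoeff_C]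
  · rw [← Ideal.mem_span_singleton]
    refine (Ideal.span_le.mpr ?_) (Submodule.IsPrincipal.generator_mem _)
    rintro _ ⟨n, rfl⟩
    refine Ideal.mem_span_singleton.mpr ⟨p.coeff n, ?_⟩
    exact coeff_smul g p n

theorem zpow_factor_dvd {D : Type*} [CommRing D] (σ : RingAut D) {t c : D} {e f : ℤ} {n : ℕ}
    (h : t ∣ (σ ^ e) c) (hn : (n : ℤ) = f + e) : (σ ^ f) t ∣ (σ ^ n) c := by
  have := map_dvd (σ ^ f) h
  rwa [← RingAut.mul_apply, ← zpow_add, ← hn, zpow_natCast] at this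

end Ore

end

theorem corollary1 {D : Type*} [EuclideanDomain D]
    {K : Type*} [Field K] [Algebra D K] [IsFractionRing D K]
    (σ : RingAut D) (δ : Ore.PseudoDerivation σ)
    (A B : Ore.OrePoly δ) (hB : B ≠ 0) (hAB : B.order ≤ A.order)
    (ℓ : ℕ) (R : ℕ → Ore.OrePoly (Ore.fracDer K δ))
    (hR : Ore.IsSubresultantPRS (Ore.toFrac K δ A) (Ore.toFrac K δ B) ℓ R)
    (t : D)
    (ht : Ore.IsGCD t ((σ ^ ((B.order : ℤ) - 1)) A.lc) ((σ ^ ((A.order : ℤ) - 1)) B.lc))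
    (γ : ℕ → D)
    (hγ₂ : γ 2 = (σ ^ (-(B.order : ℤ) + 1)) t)
    (hγ : ∀ i, 2 < i → i ≤ ℓ →
      γ i = (σ ^ (((R (i - 2)).order : ℤ) - ((R (i - 1)).order : ℤ))) (γ (i - 1))) :
    ∀ i, 2 ≤ i → i ≤ ℓ →
      ∃ P : Ore.OrePoly δ, Ore.toFrac K δ P = R i ∧ γ i ∣ Ore.content P := by
  obtain ⟨Q, h⟩ := hR
  have hinj := IsFractionRing.injective D K
  have hoA : (Ore.toFrac K δ A).order = A.order :=
    Polynomial.natDegree_map_eq_of_injective hinj _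
  have hoB : (Ore.toFrac K δ B).order = B.order :=
    Polynomial.natDegree_map_eq_of_injective hinj _
  have hAB' : (Ore.toFrac K δ B).order ≤ (Ore.toFrac K δ A).order := by rwa [hoA, hoB]
  -- The recursion for `γ` telescopes. The bound on the order keeps the natural subtractions below
  -- exact.
  have hγ' : ∀ i, i + 2 ≤ ℓ → γ (i + 2) = (σ ^ (-((R (i + 1)).order : ℤ) + 1)) t ∧
      (R (i + 1)).order ≤ B.order := by
    intro i
    induction i with
    | zero => exact fun _ => by rw [hγ₂, zero_add, h.one, hoB]; exact ⟨rfl, le_rfl⟩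
    | succ i ih =>
      intro hi
      obtain ⟨h1, h2⟩ := ih (by omega)
      refine ⟨?_, (h.order_lt (i := i + 1) (by omega) (by omega)).le.trans h2⟩
      rw [hγ (i + 1 + 2) (by omega) hi, show i + 1 + 2 - 1 = i + 2 by omega, h1,
        ← RingAut.mul_apply, ← zpow_add]
      congr 2
      change ((R (i + 1)).order : ℤ) - ((R (i + 2)).order : ℤ) + _ = _
      ring
  intro i hi2 hi
  obtain ⟨i, rfl⟩ := Nat.exists_eq_add_of_le' hi2
  obtain ⟨hγi, hle⟩ := hγ' i hi
  have hlt := h.order_lt (i := i + 1) (by omega) hi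
  obtain ⟨u, hu, hS⟩ := Ore.subres_eq_smul_ι h hAB' hi
  have hBd : (Ore.OrePoly.toPoly B).natDegree = B.order := rfl
  have hAd : (Ore.OrePoly.toPoly A).natDegree = A.order := rfl
  -- With `j = d_(i+1) - 1` the top entry from `A` is `σ^(d_B - d_(i+1)) (lc A)`, and `d_B - d_(i+1)
  -- = (-d_(i+1) + 1) + (d_B - 1)`; symmetrically for `B`. So `γ (i + 2)` divides both.
  obtain ⟨p, hp⟩ := Ore.exists_subres_map_eq (K := K) δ (Ore.OrePoly.toPoly A)
    (Ore.OrePoly.toPoly B) (g := γ (i + 2)) (j := (R (i + 1)).order - 1) (by omega) (by omega)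
    (hγi ▸ Ore.zpow_factor_dvd σ ht.1 (by omega)) (hγi ▸ Ore.zpow_factor_dvd σ ht.2.1 (by omega))
  have hS' := hp.symm.trans hS
  rw [← map_smul, ExteriorAlgebra.ι_inj] at hS'
  have hmul : Ore.OrePoly.toPoly (R (i + 2)) =
      u • (γ (i + 2) • p).map (algebraMap D K) := by
    rw [hS', smul_smul, ← sq, hu, one_smul]
  -- The scalar `u` lives in `K`, but being `1` or `-1` it can be absorbed into `p` over `D`.
  rcases sq_eq_sq_iff_eq_or_eq_neg.mp (hu.trans (one_pow 2).symm) with rfl | rfl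
  · exact ⟨Ore.OrePoly.toPoly.symm (γ (i + 2) • p),
      Ore.OrePoly.toPoly.injective (by rw [hmul, one_smul]; rfl), Ore.dvd_content_smul _ _⟩
  · refine ⟨Ore.OrePoly.toPoly.symm (γ (i + 2) • -p),
      Ore.OrePoly.toPoly.injective ?_, Ore.dvd_content_smul _ _⟩
    rw [hmul, neg_one_smul, ← Polynomial.map_neg, ← smul_neg]
    rfl
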